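/- **Conventions.** Manifolds are smooth, finite-dimensional, Hausdorff and second countable. $\mathbb R^\times$ denotes either $\mathbb R\setminus\{0\}$ or $\mathbb R^+$. For a bivector field $\Pi$ put $\{F,G\}=\Pi(dF,dG)$; $\Pi$ is a Poisson structure if this bracket on $C^\infty(P)$ satisfies the Jacobi identity. The Hamiltonian vector field of $H$ is $X_H=-i(dH)\Pi=\Pi(\cdot,dH)$, i.e. $X_H(F)=\{F,H\}$. A *Kirillov bracket* on the sections of a line bundle $L^*\to K$ is a real Lie bracket $[\cdot,\cdot]$ on $\Gamma(L^*)$ such that for every $h\in\Gamma(L^*)$ there is a vector field $X_h$ on $K$, the *symbol* of $[\cdot,h]$, with $[fh_1,h]=f[h_1,h]+X_h(f)\,h_1$ for all $f\in C^\infty(K)$, $h_1\in\Gamma(L^*)$. **Theorem.** Let $p:P\to K=P/\mathbb R^\times$ be a principal $\mathbb R^\times$-bundle with action $\phi$, and let $\Pi$ be a Poisson structure on $P$ with $\wedge^2T\phi_s\circ\Pi=s\,\Pi\circ\phi_s$ for all $s\in\mathbb R^\times$. Let $L=(P\times\mathbb R)/\mathbb R^\times\to K$ be the line bundle associated with the action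 $s\cdot(x,t)=(\phi_s(x),t/s)$, and $L^*$ its dual. (a) The map $h\mapsto H_h$, $H_h(x)=h(p(x))([x,1])$, is a bijection from the smooth sections of $L^*$ onto the smooth functions $H:P\to\mathbb R$ with $H\circ\phi_s=sH$ for all $s\in\mathbb R^\times$; moreover $h(p(x))([x,t])=t\,H_h(x)$ for all $x\in P$, $t\in\mathbb R$. (b) There is a unique Kirillov bracket $[\cdot,\cdot]$ on $\Gamma(L^*)$ such that $\{H_{h_1},H_{h_2}\}=-H_{[h_1,h_2]}$ for all $h_1,h_2\in\Gamma(L^*)$. The symbol $X_h$ of $[\cdot,h]$ is uniquely determined by $h$. (c) For every $h\in\Gamma(L^*)$ the Hamiltonian vector field $X_{H_h}$ is $p$-projectable, and its projection is the symbol of the derivation $[h,\cdot]$, that is, the vector field $-X_h$: $Tp\circ X_{H_h}=-X_h\circ p$. (d) $[X_{h_1},X_{h_2}]=-X_{[h_1,h_2]}$ for all $h_1,h_2\in\Gamma(L^*)$. -/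

import Mathlib

open Bundle Set Topology
open scoped Manifold ContDiff Bundle Topology

noncomputable section

namespace ScalingReduction

/-! ## The scaling group

`ℝ^×` stands for either of the Lie groups `ℝ ∖ {0}` and `ℝ⁺`. These are exactly the open subgroups
of `ℝˣ`, see `openSubgroup_units_real`. -/

/-- An open subgroup of `ℝˣ` is an open submanifold of `ℝˣ`. -/
instance instChartedSpaceScale (G : OpenSubgroup ℝˣ) : ChartedSpace ℝ G :=
  inferInstanceAs (ChartedSpace ℝ (G : TopologicalSpace.Opens ℝˣ))

instance instIsManifoldScale (G : OpenSubgroup ℝˣ) : IsManifold 𝓘(ℝ, ℝ) ∞ G :=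
  inferInstanceAs (IsManifold 𝓘(ℝ, ℝ) ∞ (G : TopologicalSpace.Opens ℝˣ))

/-- The real number underlying an element of the scaling group. -/
def scale {G : OpenSubgroup ℝˣ} (s : G) : ℝ := ((s : ℝˣ) : ℝ)

theorem openSubgroup_units_real (G : OpenSubgroup ℝˣ) :
    (G : Set ℝˣ) = univ ∨ (G : Set ℝˣ) = {s : ℝˣ | 0 < (s : ℝ)} := by
  have hpos : ∀ s : ℝˣ, 0 < (s : ℝ) → s ∈ G := by
    intro s hs
    let f : ℝ → ℝˣ := fun r => Units.mk0 (Real.exp r) (Real.exp_pos r).ne'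
    have hf : Continuous f := by
      rw [Units.isOpenEmbedding_val.isEmbedding.continuous_iff]
      exact Real.continuous_exp
    have hmem : {r | f r ∈ G} ∈ 𝓝 (0 : ℝ) := by
      apply hf.continuousAt.preimage_mem_nhds
      have : f 0 = 1 := by ext; simp [f]
      rw [this]
      exact G.isOpen.mem_nhds G.one_mem
    have htend : Filter.Tendsto (fun n : ℕ => Real.log s / (n + 1 : ℝ)) Filter.atTop (𝓝 0) := by
      have := tendsto_one_div_add_atTop_nhds_zero_nat (𝕜 := ℝ) |>.const_mul (Real.log s)
      simpa [div_eq_mul_inv] using this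
    obtain ⟨n, hn⟩ := (htend.eventually hmem).exists
    have hpow : f (Real.log s / (n + 1 : ℝ)) ^ (n + 1) = s := by
      ext
      simp only [f, Units.val_pow_eq_pow_val, Units.val_mk0]
      rw [← Real.exp_nat_mul]
      push_cast
      rw [mul_div_cancel₀ _ (by positivity), Real.exp_log hs]
    rw [← hpow]
    exact G.toSubgroup.pow_mem hn _
  by_cases h : ∃ s ∈ G, (s : ℝ) < 0
  · left
    obtain ⟨s, hs, hneg⟩ := h
    ext t
    simp only [SetLike.mem_coe, mem_univ, iff_true]
    rcases lt_or_gt_of_ne t.ne_zero with ht | ht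
    · have : t = s * (s⁻¹ * t) := by group
      rw [this]
      refine G.mul_mem hs (hpos _ ?_)
      rw [Units.val_mul, Units.val_inv_eq_inv_val]
      exact mul_pos_of_neg_of_neg (inv_lt_zero.2 hneg) ht
    · exact hpos t ht
  · right
    push Not at h
    ext t
    exact ⟨fun ht => lt_of_le_of_ne (h t ht) t.ne_zero.symm, hpos t⟩

theorem scale_ne_zero {G : OpenSubgroup ℝˣ} (s : G) : scale s ≠ 0 := Units.ne_zero _

@[simp]
theorem scale_one {G : OpenSubgroup ℝˣ} : scale (1 : G) = 1 := rfl

@[simp]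
theorem scale_mul {G : OpenSubgroup ℝˣ} (s t : G) : scale (s * t) = scale s * scale t := rfl

@[simp]
theorem scale_inv {G : OpenSubgroup ℝˣ} (s : G) : scale s⁻¹ = (scale s)⁻¹ :=
  Units.val_inv_eq_inv_val _

theorem contMDiff_scale {G : OpenSubgroup ℝˣ} :
    ContMDiff 𝓘(ℝ, ℝ) 𝓘(ℝ, ℝ) ∞ (scale : G → ℝ) :=
  Units.contMDiff_val.comp
    (contMDiff_subtype_val (I := 𝓘(ℝ, ℝ)) (U := (G : TopologicalSpace.Opens ℝˣ)))

/-! ## Principal bundles -/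

/-- A principal bundle `proj : P → K` with structure group `G` (`ℝ ∖ {0}` or `ℝ⁺`): a smooth action
of `G` on `P`, and around every point of `K` a smooth equivariant local trivialization
`proj ⁻¹' U ≃ U × G`. Consequently the action is free, `proj` is a surjective submersion
and its fibres are the orbits, so that `K` is the orbit manifold `P / G`. -/
structure ScalingBundle (G : OpenSubgroup ℝˣ)
    (EP : Type*) [NormedAddCommGroup EP] [NormedSpace ℝ EP]
    (P : Type*) [TopologicalSpace P] [ChartedSpace EP P] [MulAction G P]
    (EK : Type*) [NormedAddCommGroup EK] [NormedSpace ℝ EK]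
    (K : Type*) [TopologicalSpace K] [ChartedSpace EK K] where
  proj : P → K
  contMDiff_smul : ContMDiff (𝓘(ℝ, ℝ).prod 𝓘(ℝ, EP)) 𝓘(ℝ, EP) ∞ (fun q : G × P => q.1 • q.2)
  proj_smul : ∀ (s : G) (x : P), proj (s • x) = proj x
  exists_trivialization : ∀ k : K, ∃ e : Trivialization G proj, k ∈ e.baseSet ∧
    ContMDiffOn 𝓘(ℝ, EP) (𝓘(ℝ, EK).prod 𝓘(ℝ, ℝ)) ∞ e e.source ∧
    ContMDiffOn (𝓘(ℝ, EK).prod 𝓘(ℝ, ℝ)) 𝓘(ℝ, EP) ∞ e.toOpenPartialHomeomorph.symm e.target ∧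
    ∀ (s : G), ∀ x ∈ e.source, (e (s • x)).2 = s * (e x).2

namespace ScalingBundle

variable {G : OpenSubgroup ℝˣ}
  {EP : Type*} [NormedAddCommGroup EP] [NormedSpace ℝ EP]
  {P : Type*} [TopologicalSpace P] [ChartedSpace EP P] [MulAction G P]
  {EK : Type*} [NormedAddCommGroup EK] [NormedSpace ℝ EK]
  {K : Type*} [TopologicalSpace K] [ChartedSpace EK K]
  (B : ScalingBundle G EP P EK K)

/-- The smooth equivariant local trivializations of a principal bundle. -/
structure Triv where
  e : Trivialization G B.proj
  smooth : ContMDiffOn 𝓘(ℝ, EP) (𝓘(ℝ, EK).prod 𝓘(ℝ, ℝ)) ∞ e e.source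
  smooth_symm :
    ContMDiffOn (𝓘(ℝ, EK).prod 𝓘(ℝ, ℝ)) 𝓘(ℝ, EP) ∞ e.toOpenPartialHomeomorph.symm e.target
  equivariant : ∀ (s : G), ∀ x ∈ e.source, (e (s • x)).2 = s * (e x).2

theorem exists_triv (k : K) : ∃ T : B.Triv, k ∈ T.e.baseSet := by
  obtain ⟨e, hk, h1, h2, h3⟩ := B.exists_trivialization k
  exact ⟨⟨e, h1, h2, h3⟩, hk⟩

variable {B}

theorem Triv.smul_mem (T : B.Triv) {x : P} (hx : x ∈ T.e.source) (s : G) :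
    s • x ∈ T.e.source := by
  rw [T.e.mem_source] at hx ⊢
  rwa [B.proj_smul]

variable (B)

theorem eq_one_of_smul_eq (B : ScalingBundle G EP P EK K) {s : G} {x : P} (h : s • x = x) : s = 1 := by
  obtain ⟨T, hT⟩ := B.exists_triv (B.proj x)
  have := T.equivariant s x (T.e.mem_source.2 hT)
  rw [h] at this
  exact (mul_eq_right.1 this.symm)

theorem exists_smul_eq {x y : P} (h : B.proj x = B.proj y) : ∃ s : G, y = s • x := by
  obtain ⟨T, hT⟩ := B.exists_triv (B.proj x)
  have hx : x ∈ T.e.source := T.e.mem_source.2 hT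
  have hy : y ∈ T.e.source := T.e.mem_source.2 (h ▸ hT)
  refine ⟨(T.e y).2 * (T.e x).2⁻¹, T.e.injOn hy (T.smul_mem hx _) ?_⟩
  refine Prod.ext ?_ ?_
  · change (T.e y).1 = (T.e (_ • x)).1
    rw [T.e.coe_fst hy, T.e.coe_fst (T.smul_mem hx _), B.proj_smul, h]
  · change (T.e y).2 = (T.e (_ • x)).2
    rw [T.equivariant _ _ hx]
    group

theorem proj_surjective : Function.Surjective B.proj := by
  intro k
  obtain ⟨T, hT⟩ := B.exists_triv k
  exact ⟨T.e.toOpenPartialHomeomorph.symm (k, 1), T.e.proj_symm_apply' hT⟩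

/-! ## The associated line bundle

`L = (P × ℝ) / G` for the action `s · (x, t) = (s · x, t / s)`, with fibres
`L_k = (proj ⁻¹' {k} × ℝ) / G`. -/

/-- The orbit relation of the action `s · (x, t) = (s · x, t / s)` over the point `k`. -/
def lineSetoid (k : K) : Setoid ({x : P // B.proj x = k} × ℝ) where
  r a b := ∃ s : G, (b.1 : P) = s • (a.1 : P) ∧ b.2 = a.2 / scale s
  iseqv :=
    { refl := fun a => ⟨1, by simp, by simp⟩
      symm := by
        rintro a b ⟨s, h1, h2⟩
        refine ⟨s⁻¹, by rw [h1, inv_smul_smul], ?_⟩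
        rw [h2, scale_inv]
        field_simp [scale_ne_zero s]
      trans := by
        rintro a b c ⟨s, h1, h2⟩ ⟨t, h3, h4⟩
        refine ⟨t * s, by rw [h3, h1, mul_smul], ?_⟩
        rw [h4, h2, scale_mul, div_div, mul_comm] }

/-- The fibre `L_k` of the associated line bundle. -/
def LineFiber (k : K) : Type _ := Quotient (B.lineSetoid k)

/-- The class of `(x, t)` in the fibre over `k = proj x`. -/
def fiberMk {k : K} (x : {x : P // B.proj x = k}) (t : ℝ) : B.LineFiber k :=
  Quotient.mk (B.lineSetoid k) (x, t)

/-- The quotient map `P × ℝ → L`. -/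
def lineMk (x : P) (t : ℝ) : B.LineFiber (B.proj x) := B.fiberMk ⟨x, rfl⟩ t

theorem fiberMk_bijective {k : K} (x : {x : P // B.proj x = k}) :
    Function.Bijective (B.fiberMk x) := by
  constructor
  · intro t u h
    obtain ⟨s, h1, h2⟩ := Quotient.exact h
    have : s = 1 := B.eq_one_of_smul_eq h1.symm
    subst this
    simpa using h2.symm
  · intro z
    induction z using Quotient.inductionOn with
    | h a =>
      obtain ⟨y, u⟩ := a
      obtain ⟨s, hs⟩ := B.exists_smul_eq (y.2.trans x.2.symm)
      exact ⟨u / scale s, (Quotient.sound ⟨s, hs, rfl⟩ :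
        Quotient.mk (B.lineSetoid k) (y, u) = Quotient.mk (B.lineSetoid k) _).symm⟩

/-- A point of the fibre of `P` over `k`. -/
def pt (k : K) : {x : P // B.proj x = k} :=
  ⟨(B.proj_surjective k).choose, (B.proj_surjective k).choose_spec⟩

/-- The identification of `L_k` with `ℝ` given by a point of the fibre of `P` over `k`. -/
def fiberEquiv (k : K) : B.LineFiber k ≃ ℝ :=
  (Equiv.ofBijective _ (B.fiberMk_bijective (B.pt k))).symm

/-- The vector space structure of `L_k`; it does not depend on the point of the fibre used to
define it, see `fiberMk_add` and `smul_fiberMk`. -/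
instance instAddCommGroupLineFiber (k : K) : AddCommGroup (B.LineFiber k) :=
  (B.fiberEquiv k).addCommGroup

instance instModuleLineFiber (k : K) : Module ℝ (B.LineFiber k) :=
  (B.fiberEquiv k).module ℝ

instance instTopologicalSpaceLineFiber (k : K) : TopologicalSpace (B.LineFiber k) :=
  TopologicalSpace.induced (B.fiberEquiv k) inferInstance

/-- `fiberEquiv` as a linear equivalence. -/
def fiberLinearEquiv (k : K) : B.LineFiber k ≃ₗ[ℝ] ℝ := (B.fiberEquiv k).linearEquiv ℝ

theorem fiberEquiv_symm_apply (k : K) (t : ℝ) :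
    (B.fiberLinearEquiv k).symm t = B.fiberMk (B.pt k) t := rfl

theorem fiberMk_smul {k : K} {x y : {x : P // B.proj x = k}} {s : G}
    (h : (y : P) = s • (x : P)) (t : ℝ) : B.fiberMk y t = B.fiberMk x (scale s * t) := by
  refine (Quotient.sound ⟨s, h, ?_⟩ :
    Quotient.mk (B.lineSetoid k) (x, scale s * t) = Quotient.mk (B.lineSetoid k) (y, t)).symm
  field_simp [scale_ne_zero s]

theorem fiberLinearEquiv_fiberMk {k : K} {x : {x : P // B.proj x = k}} {s : G}
    (h : (x : P) = s • (B.pt k : P)) (t : ℝ) :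
    B.fiberLinearEquiv k (B.fiberMk x t) = scale s * t := by
  rw [B.fiberMk_smul h, ← fiberEquiv_symm_apply, LinearEquiv.apply_symm_apply]

theorem fiberMk_add {k : K} (x : {x : P // B.proj x = k}) (t u : ℝ) :
    B.fiberMk x (t + u) = B.fiberMk x t + B.fiberMk x u := by
  obtain ⟨s, hs⟩ := B.exists_smul_eq ((B.pt k).2.trans x.2.symm)
  apply (B.fiberLinearEquiv k).injective
  rw [map_add]
  simp only [B.fiberLinearEquiv_fiberMk hs]
  ring

theorem smul_fiberMk {k : K} (x : {x : P // B.proj x = k}) (c t : ℝ) :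
    c • B.fiberMk x t = B.fiberMk x (c * t) := by
  obtain ⟨s, hs⟩ := B.exists_smul_eq ((B.pt k).2.trans x.2.symm)
  apply (B.fiberLinearEquiv k).injective
  rw [map_smul]
  simp only [B.fiberLinearEquiv_fiberMk hs, smul_eq_mul]
  ring

variable {B}

/-- The homogeneous function `τ : proj ⁻¹' U → ℝ^×` given by a local trivialization. -/
def Triv.tau (T : B.Triv) (x : P) : ℝ := scale (T.e x).2

theorem Triv.tau_ne_zero (T : B.Triv) (x : P) : T.tau x ≠ 0 := scale_ne_zero _

theorem Triv.tau_smul (T : B.Triv) {x : P} (hx : B.proj x ∈ T.e.baseSet) (s : G) :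
    T.tau (s • x) = scale s * T.tau x := by
  rw [Triv.tau, T.equivariant s x (T.e.mem_source.2 hx), scale_mul, Triv.tau]

/-- The local trivialization `[x, t] ↦ (proj x, t * τ x)` of the associated line bundle given by a
local trivialization `x ↦ (proj x, τ x)` of the principal bundle, see `lineTriv_mk`. -/
def Triv.lineTriv (T : B.Triv) : Pretrivialization ℝ (π ℝ B.LineFiber) where
  toFun z := (z.1, T.tau (B.pt z.1) * B.fiberLinearEquiv z.1 z.2)
  invFun z := ⟨z.1, (B.fiberLinearEquiv z.1).symm (z.2 / T.tau (B.pt z.1))⟩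
  source := π ℝ B.LineFiber ⁻¹' T.e.baseSet
  target := T.e.baseSet ×ˢ univ
  map_source' z hz := ⟨hz, mem_univ _⟩
  map_target' z hz := hz.1
  left_inv' := by
    rintro ⟨k, l⟩ -
    simp [mul_div_cancel_left₀ _ (T.tau_ne_zero (B.pt k))]
  right_inv' := by
    rintro ⟨k, u⟩ -
    simp [mul_div_cancel₀ _ (T.tau_ne_zero (B.pt k))]
  open_target := T.e.open_baseSet.prod isOpen_univ
  baseSet := T.e.baseSet
  open_baseSet := T.e.open_baseSet
  source_eq := rfl
  target_eq := rfl
  proj_toFun _ _ := rfl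

theorem Triv.lineTriv_mk (T : B.Triv) {x : P} (hx : B.proj x ∈ T.e.baseSet) (t : ℝ) :
    T.lineTriv ⟨B.proj x, B.lineMk x t⟩ = (B.proj x, t * T.tau x) := by
  obtain ⟨s, hs⟩ := B.exists_smul_eq (B.pt (B.proj x)).2
  have h1 : B.fiberLinearEquiv (B.proj x) (B.lineMk x t) = scale s * t :=
    B.fiberLinearEquiv_fiberMk (x := ⟨x, rfl⟩) hs t
  have h2 : T.tau x = scale s * T.tau (B.pt (B.proj x)) := by
    conv_lhs => rw [hs]
    exact T.tau_smul (by rwa [(B.pt (B.proj x)).2]) s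
  change (B.proj x, T.tau (B.pt (B.proj x)) * B.fiberLinearEquiv (B.proj x) (B.lineMk x t)) = _
  rw [h1, h2]
  congr 1
  ring

theorem Triv.ratio_eq (T T' : B.Triv) {k : K} (hk : k ∈ T.e.baseSet ∩ T'.e.baseSet) :
    T'.tau (B.pt k) / T.tau (B.pt k) =
      scale (T'.e (T.e.toOpenPartialHomeomorph.symm (k, 1))).2 := by
  set y := T.e.toOpenPartialHomeomorph.symm (k, 1) with hy
  have hyk : B.proj y = k := T.e.proj_symm_apply' hk.1
  have hτ : T.tau y = 1 := by
    rw [Triv.tau, hy, T.e.apply_symm_apply' hk.1]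
    rfl
  obtain ⟨s, hs⟩ := B.exists_smul_eq (hyk.trans (B.pt k).2.symm)
  rw [hs, T'.tau_smul (by rw [hyk]; exact hk.2), T.tau_smul (by rw [hyk]; exact hk.1), hτ, mul_one,
    mul_div_cancel_left₀ _ (scale_ne_zero s)]
  rfl

theorem Triv.contMDiffOn_ratio (T T' : B.Triv) :
    ContMDiffOn 𝓘(ℝ, EK) 𝓘(ℝ, ℝ) ∞ (fun k => T'.tau (B.pt k) / T.tau (B.pt k))
      (T.e.baseSet ∩ T'.e.baseSet) := by
  have h1 : ContMDiffOn 𝓘(ℝ, EK) 𝓘(ℝ, EP) ∞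
      (fun k => T.e.toOpenPartialHomeomorph.symm (k, (1 : G))) (T.e.baseSet ∩ T'.e.baseSet) :=
    T.smooth_symm.comp (contMDiff_id.prodMk contMDiff_const).contMDiffOn
      (fun k hk => by rw [T.e.target_eq]; exact ⟨hk.1, mem_univ _⟩)
  have h2 : ContMDiffOn 𝓘(ℝ, EK) (𝓘(ℝ, EK).prod 𝓘(ℝ, ℝ)) ∞
      (fun k => T'.e (T.e.toOpenPartialHomeomorph.symm (k, (1 : G))))
      (T.e.baseSet ∩ T'.e.baseSet) :=
    T'.smooth.comp h1 (fun k hk => by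
      rw [mem_preimage, T'.e.mem_source, T.e.proj_symm_apply' hk.1]; exact hk.2)
  refine ((contMDiff_scale.comp contMDiff_snd).comp_contMDiffOn h2).congr fun k hk => ?_
  exact T.ratio_eq T' hk

variable (B)

theorem exists_lineCoordChange (T T' : B.Triv) : ∃ f : K → ℝ →L[ℝ] ℝ,
    ContMDiffOn 𝓘(ℝ, EK) 𝓘(ℝ, ℝ →L[ℝ] ℝ) ∞ f (T.lineTriv.baseSet ∩ T'.lineTriv.baseSet) ∧
      ∀ k ∈ T.lineTriv.baseSet ∩ T'.lineTriv.baseSet, ∀ v : ℝ,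
        f k v = (T'.lineTriv ⟨k, T.lineTriv.symm k v⟩).2 := by
  refine ⟨fun k => (T'.tau (B.pt k) / T.tau (B.pt k)) • ContinuousLinearMap.id ℝ ℝ, ?_, ?_⟩
  · exact (T.contMDiffOn_ratio T').smul contMDiffOn_const
  · intro k hk v
    rw [T.lineTriv.symm_apply hk.1]
    change _ = T'.tau (B.pt k) *
      B.fiberLinearEquiv k ((B.fiberLinearEquiv k).symm (v / T.tau (B.pt k)))
    rw [LinearEquiv.apply_symm_apply]
    simp only [_root_.smul_apply, ContinuousLinearMap.id_apply, smul_eq_mul]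
    ring

/-- The vector bundle atlas of the associated line bundle. -/
def linePrebundle : VectorPrebundle ℝ ℝ B.LineFiber where
  pretrivializationAtlas := range (Triv.lineTriv (B := B))
  pretrivialization_linear' := by
    rintro _ ⟨T, rfl⟩
    refine ⟨fun k hk => ⟨fun x y => ?_, fun c x => ?_⟩⟩
    · change T.tau (B.pt k) * B.fiberLinearEquiv k (x + y) =
        T.tau (B.pt k) * B.fiberLinearEquiv k x + T.tau (B.pt k) * B.fiberLinearEquiv k y
      rw [map_add, mul_add]
    · change T.tau (B.pt k) * B.fiberLinearEquiv k (c • x) =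
        c • (T.tau (B.pt k) * B.fiberLinearEquiv k x)
      rw [map_smul, smul_eq_mul, smul_eq_mul]
      ring
  pretrivializationAt k := (B.exists_triv k).choose.lineTriv
  mem_base_pretrivializationAt k := (B.exists_triv k).choose_spec
  pretrivialization_mem_atlas k := ⟨_, rfl⟩
  exists_coordChange := by
    rintro _ ⟨T, rfl⟩ _ ⟨T', rfl⟩
    obtain ⟨f, hf, h⟩ := B.exists_lineCoordChange T T'
    exact ⟨f, hf.continuousOn, h⟩
  totalSpaceMk_isInducing k := by
    have h1 : IsInducing (B.fiberLinearEquiv k) := ⟨rfl⟩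
    have h2 : IsInducing (fun u : ℝ => (k, (B.exists_triv k).choose.tau (B.pt k) * u)) :=
      (isEmbedding_prodMkRight k).isInducing.comp
        (Homeomorph.mulLeft₀ _ ((B.exists_triv k).choose.tau_ne_zero (B.pt k))).isInducing
    exact h2.comp h1

instance instTopologicalSpaceLine : TopologicalSpace (TotalSpace ℝ B.LineFiber) :=
  B.linePrebundle.totalSpaceTopology

instance instFiberBundleLine : FiberBundle ℝ B.LineFiber :=
  B.linePrebundle.toFiberBundle

instance instVectorBundleLine : VectorBundle ℝ ℝ B.LineFiber :=
  B.linePrebundle.toVectorBundle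

/-- The associated line bundle is a smooth vector bundle over `K`. -/
instance instContMDiffVectorBundleLine :
    ContMDiffVectorBundle ∞ ℝ B.LineFiber 𝓘(ℝ, EK) :=
  haveI : B.linePrebundle.IsContMDiff 𝓘(ℝ, EK) ∞ :=
    ⟨by
      rintro _ ⟨T, rfl⟩ _ ⟨T', rfl⟩
      exact B.exists_lineCoordChange T T'⟩
  B.linePrebundle.contMDiffVectorBundle 𝓘(ℝ, EK)

/-- The dual line bundle `L^*`. -/
abbrev DualFiber (k : K) : Type _ := B.LineFiber k →L[ℝ] Bundle.Trivial K ℝ k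

/-- The space `Γ(L^*)` of smooth sections of the dual line bundle. -/
abbrev DualSection : Type _ := Cₛ^∞⟮𝓘(ℝ, EK); ℝ →L[ℝ] ℝ, B.DualFiber⟯

/-- The function `H_h : P → ℝ`, `H_h(x) = h(proj x)[x, 1]`, given by a section `h` of `L^*`. -/
def homFun (h : B.DualSection) (x : P) : ℝ := h (B.proj x) (B.lineMk x 1)

end ScalingBundle

/-! ## Vector fields, Kirillov brackets -/

/-- The differential of a real function. -/
def diff {E : Type*} [NormedAddCommGroup E] [NormedSpace ℝ E]
    {M : Type*} [TopologicalSpace M] [ChartedSpace E M] (f : M → ℝ) (x : M) :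
    TangentSpace 𝓘(ℝ, E) x →L[ℝ] ℝ :=
  mfderiv 𝓘(ℝ, E) 𝓘(ℝ, ℝ) f x

/-- Smooth vector fields. -/
abbrev SmoothVectorField (E : Type*) [NormedAddCommGroup E] [NormedSpace ℝ E]
    (M : Type*) [TopologicalSpace M] [ChartedSpace E M] [IsManifold 𝓘(ℝ, E) ∞ M] : Type _ :=
  Cₛ^∞⟮𝓘(ℝ, E); E, (TangentSpace 𝓘(ℝ, E) : M → Type _)⟯

section Kirillov

variable {E : Type*} [NormedAddCommGroup E] [NormedSpace ℝ E]
  {K : Type*} [TopologicalSpace K] [ChartedSpace E K]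
  {F : Type*} [NormedAddCommGroup F] [NormedSpace ℝ F]
  {V : K → Type*} [TopologicalSpace (TotalSpace F V)]
  [∀ k, AddCommGroup (V k)] [∀ k, Module ℝ (V k)] [∀ k, TopologicalSpace (V k)]
  [FiberBundle F V] [VectorBundle ℝ F V]

/-- The product `f h` of a smooth function and a smooth section. -/
def smulSection (f : C^∞⟮𝓘(ℝ, E), K; ℝ⟯) (h : Cₛ^∞⟮𝓘(ℝ, E); F, V⟯) : Cₛ^∞⟮𝓘(ℝ, E); F, V⟯ :=
  ⟨fun k => f k • h k, f.contMDiff.smul_section h.contMDiff⟩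

variable [IsManifold 𝓘(ℝ, E) ∞ K]

/-- `X` is a symbol of the operator `D` on sections:
`D (f h) = f D(h) + X(f) h`. -/
def IsSymbol (D : Cₛ^∞⟮𝓘(ℝ, E); F, V⟯ → Cₛ^∞⟮𝓘(ℝ, E); F, V⟯) (X : SmoothVectorField E K) : Prop :=
  ∀ (f : C^∞⟮𝓘(ℝ, E), K; ℝ⟯) (h : Cₛ^∞⟮𝓘(ℝ, E); F, V⟯) (k : K),
    D (smulSection f h) k = f k • D h k + diff f k (X k) • h k

variable (E F V) in
/-- A Kirillov bracket (local Lie algebra bracket) on the sections of the vector bundle `V`: a real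
Lie bracket such that `[·, h]` is a derivation with some symbol for every section `h`. -/
structure KirillovBracket where
  bracket : Cₛ^∞⟮𝓘(ℝ, E); F, V⟯ →ₗ[ℝ] Cₛ^∞⟮𝓘(ℝ, E); F, V⟯ →ₗ[ℝ] Cₛ^∞⟮𝓘(ℝ, E); F, V⟯
  bracket_self : ∀ h, bracket h h = 0
  jacobi : ∀ h₁ h₂ h₃, bracket (bracket h₁ h₂) h₃ + bracket (bracket h₂ h₃) h₁ +
    bracket (bracket h₃ h₁) h₂ = 0
  exists_symbol : ∀ h, ∃ X : SmoothVectorField E K, IsSymbol (fun h₁ => bracket h₁ h) X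

/-- The symbol `X_h` of the derivation `[·, h]`. -/
def KirillovBracket.symbol (κ : KirillovBracket E F V) (h : Cₛ^∞⟮𝓘(ℝ, E); F, V⟯) :
    SmoothVectorField E K :=
  (κ.exists_symbol h).choose

end Kirillov

/-! ## Poisson structures -/

section Poisson

variable (E : Type*) [NormedAddCommGroup E] [NormedSpace ℝ E]
  (P : Type*) [TopologicalSpace P] [ChartedSpace E P] [IsManifold 𝓘(ℝ, E) ∞ P]

/-- A smooth bivector field `Π` on `P`, given by the skew-symmetric bundle map `T^*P → TP`,
`α ↦ i(α)Π = Π(α, ·)`. -/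
structure Bivector where
  sharp : ∀ x : P, (TangentSpace 𝓘(ℝ, E) x →L[ℝ] Bundle.Trivial P ℝ x) →L[ℝ]
    TangentSpace 𝓘(ℝ, E) x
  contMDiff_sharp : ContMDiff 𝓘(ℝ, E) (𝓘(ℝ, E).prod 𝓘(ℝ, (E →L[ℝ] ℝ) →L[ℝ] E)) ∞
    (fun x => TotalSpace.mk' ((E →L[ℝ] ℝ) →L[ℝ] E)
      (E := fun x : P => (TangentSpace 𝓘(ℝ, E) x →L[ℝ] Bundle.Trivial P ℝ x) →L[ℝ]
        TangentSpace 𝓘(ℝ, E) x) x (sharp x))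
  skew : ∀ (x : P) (α β : TangentSpace 𝓘(ℝ, E) x →L[ℝ] ℝ), β (sharp x α) = -α (sharp x β)

variable {E P}

/-- The value `Π(α, β)` on covectors. -/
def Bivector.eval (Λ : Bivector E P) (x : P) (α β : TangentSpace 𝓘(ℝ, E) x →L[ℝ] ℝ) : ℝ :=
  β (Λ.sharp x α)

/-- The bracket `{F₁, F₂} = Π(dF₁, dF₂)`. -/
def Bivector.poissonBracket (Λ : Bivector E P) (F₁ F₂ : P → ℝ) (x : P) : ℝ :=
  Λ.eval x (diff F₁ x) (diff F₂ x)

/-- The Hamiltonian vector field `X_H = -i(dH)Π = Π(·, dH)`, so that `X_H(F) = {F, H}`. -/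
def Bivector.hamiltonian (Λ : Bivector E P) (H : P → ℝ) (x : P) : TangentSpace 𝓘(ℝ, E) x :=
  -Λ.sharp x (diff H x)

/-- `Π` is a Poisson structure: its bracket of smooth functions satisfies the Jacobi identity. -/
def Bivector.IsPoisson (Λ : Bivector E P) : Prop :=
  ∀ F₁ F₂ F₃ : C^∞⟮𝓘(ℝ, E), P; ℝ⟯, ∀ x : P,
    Λ.poissonBracket (Λ.poissonBracket F₁ F₂) F₃ x +
      Λ.poissonBracket (Λ.poissonBracket F₂ F₃) F₁ x +
      Λ.poissonBracket (Λ.poissonBracket F₃ F₁) F₂ x = 0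

variable (G : OpenSubgroup ℝˣ) [MulAction G P]

/-- `∧²Tφ_s ∘ Π = s Π ∘ φ_s` for the action `φ_s x = s • x`, tested on pairs of covectors. -/
def Bivector.IsHomogeneous (Λ : Bivector E P) : Prop :=
  ∀ (s : G) (x : P) (α β : TangentSpace 𝓘(ℝ, E) (s • x) →L[ℝ] ℝ),
    Λ.eval x (α.comp (mfderiv 𝓘(ℝ, E) 𝓘(ℝ, E) (fun y : P => s • y) x))
        (β.comp (mfderiv 𝓘(ℝ, E) 𝓘(ℝ, E) (fun y : P => s • y) x)) =
      scale s * Λ.eval (s • x) α β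

variable (E P) in
/-- The smooth homogeneous functions: `H ∘ φ_s = s H`. -/
def homogeneousFunctions : Set (P → ℝ) :=
  {H | ContMDiff 𝓘(ℝ, E) 𝓘(ℝ, ℝ) ∞ H ∧ ∀ (s : G) (x : P), H (s • x) = scale s * H x}

end Poisson

end ScalingReduction

end

open ScalingReduction

/-!
By homogeneity of `Π`, the bracket of functions of degrees `a` and `b` has degree `a + b - 1`.
Functions of degree `1`, which are the sections of `L^*`, are therefore closed under the bracket.
For `f` on `K` and `H` of degree `1` the function `{f ∘ p, H}` has degree `0`, so `X_H` descends to
`K`, and the Leibniz rule for `{·, H}` exhibits its projection as minus a symbol.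

A symbol is determined by its operator, so identities between symbols follow from identities between
operators: the symbol of `[D₁, D₂]` is the Lie bracket of the symbols, and
`[X_{h₁}, X_{h₂}] = -X_{[h₁, h₂]}` is the Jacobi identity.
-/

namespace ScalingReduction

open VectorField Filter

section Manifold

variable {E : Type*} [NormedAddCommGroup E] [NormedSpace ℝ E]
  {M : Type*} [TopologicalSpace M] [ChartedSpace E M]

theorem diff_eq_mvfderiv (f : M → ℝ) : diff f = mvfderiv 𝓘(ℝ, E) f :=
  rfl

variable [IsManifold 𝓘(ℝ, E) ∞ M]

theorem contMDiff_diff {f : M → ℝ} (hf : CMDiff ∞ f) :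
    ContMDiff 𝓘(ℝ, E) (𝓘(ℝ, E).prod 𝓘(ℝ, E →L[ℝ] ℝ)) ∞
      (fun x => TotalSpace.mk' (E →L[ℝ] ℝ)
        (E := fun x : M => TangentSpace 𝓘(ℝ, E) x →L[ℝ] Bundle.Trivial M ℝ x) x (diff f x)) := by
  intro x
  rw [contMDiffAt_hom_bundle]
  refine ⟨contMDiffAt_id, ?_⟩
  have hmfderiv := (hf x).mfderiv_const (m := ∞) (by simp)
  refine hmfderiv.congr_of_eventuallyEq (Eventually.of_forall fun y => ?_)
  simp only [inTangentCoordinates, ContinuousLinearMap.inCoordinates]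
  rw [TangentBundle.continuousLinearMapAt_model_space]
  have htriv : (trivializationAt ℝ (Bundle.Trivial M ℝ) x).continuousLinearMapAt ℝ y =
      ContinuousLinearMap.id ℝ ℝ := Bundle.Trivial.continuousLinearMapAt_trivialization ..
  ext v
  exact DFunLike.congr_fun htriv _

theorem contMDiff_diff_apply {f : M → ℝ} {V : ∀ x : M, TangentSpace 𝓘(ℝ, E) x}
    (hf : CMDiff ∞ f) (hV : CMDiff ∞ (T% V)) : CMDiff ∞ (fun x => diff f x (V x)) := fun x =>
  (contMDiffAt_totalSpace.1 ((contMDiff_diff hf).clm_bundle_apply hV x)).2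

theorem contMDiffAt_mlieBracket [CompleteSpace E] {V W : ∀ x : M, TangentSpace 𝓘(ℝ, E) x} {x : M}
    (hV : CMDiffAt ∞ (T% V) x) (hW : CMDiffAt ∞ (T% W) x) :
    CMDiffAt ∞ (T% (mlieBracket 𝓘(ℝ, E) V W)) x := by
  have : IsManifold 𝓘(ℝ, E) (minSmoothness ℝ 2) M := by
    rw [minSmoothness_of_isRCLikeNormedField]
    infer_instance
  have : IsManifold 𝓘(ℝ, E) (∞ + 1) M := ‹IsManifold 𝓘(ℝ, E) ∞ M›
  exact hV.mlieBracket_vectorField (m := ⊤) (n := ⊤) hW (by simp)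

theorem mlieBracket_mlieBracket_smul [CompleteSpace E] {f : M → ℝ}
    {V W Z : ∀ x : M, TangentSpace 𝓘(ℝ, E) x} {x : M} (hf : CMDiff ∞ f) (hW : CMDiff ∞ (T% W))
    (hZ : ∀ᶠ y in 𝓝 x, CMDiffAt ∞ (T% Z) y) :
    mlieBracket 𝓘(ℝ, E) V (mlieBracket 𝓘(ℝ, E) W (f • Z)) x =
      diff (fun y => diff f y (W y)) x (V x) • Z x
        + diff f x (W x) • mlieBracket 𝓘(ℝ, E) V Z x
        + diff f x (V x) • mlieBracket 𝓘(ℝ, E) W Z x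
        + f x • mlieBracket 𝓘(ℝ, E) V (mlieBracket 𝓘(ℝ, E) W Z) x := by
  have hZx := hZ.self_of_nhds
  have hWf := contMDiff_diff_apply hf hW
  have hWZ := contMDiffAt_mlieBracket (hW x) hZx
  have hbracket : mlieBracket 𝓘(ℝ, E) W (f • Z) =ᶠ[𝓝 x]
      (fun y => diff f y (W y)) • Z + f • mlieBracket 𝓘(ℝ, E) W Z := by
    filter_upwards [hZ] with y hy
    exact mlieBracket_smul_right (hf.mdifferentiable (by simp) y) (hy.mdifferentiableAt (by simp))
  rw [EventuallyEq.rfl.mlieBracket_vectorField_eq hbracket,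
    mlieBracket_add_right (((hWf x).smul_section hZx).mdifferentiableAt (by simp))
      (((hf x).smul_section hWZ).mdifferentiableAt (by simp)),
    mlieBracket_smul_right (hWf.mdifferentiable (by simp) x) (hZx.mdifferentiableAt (by simp)),
    mlieBracket_smul_right (hf.mdifferentiable (by simp) x) (hWZ.mdifferentiableAt (by simp))]
  simp only [← diff_eq_mvfderiv]
  abel

-- Compare the Jacobi identity of `V`, `W`, `f • Z` with that of `V`, `W`, `Z`, where `Z x = z`.
theorem diff_mlieBracket_smul [CompleteSpace E] {f : M → ℝ}
    {V W : ∀ x : M, TangentSpace 𝓘(ℝ, E) x}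
    (hf : CMDiff ∞ f) (hV : CMDiff ∞ (T% V)) (hW : CMDiff ∞ (T% W)) {x : M}
    (z : TangentSpace 𝓘(ℝ, E) x) :
    diff f x (mlieBracket 𝓘(ℝ, E) V W x) • z =
      (diff (fun y => diff f y (W y)) x (V x) - diff (fun y => diff f y (V y)) x (W x)) • z := by
  have : IsManifold 𝓘(ℝ, E) (minSmoothness ℝ 3) M := by
    rw [minSmoothness_of_isRCLikeNormedField]
    infer_instance
  have hsmooth {U : ∀ x : M, TangentSpace 𝓘(ℝ, E) x} (hU : CMDiffAt ∞ (T% U) x) :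
      CMDiffAt (minSmoothness ℝ 2) (T% U) x :=
    hU.of_le (by simpa using ENat.LEInfty.out)
  obtain ⟨Z, hZ, rfl⟩ : ∃ Z : ∀ x : M, TangentSpace 𝓘(ℝ, E) x,
      (∀ᶠ y in 𝓝 x, CMDiffAt ∞ (T% Z) y) ∧ Z x = z := by
    obtain ⟨s, hs, hZs⟩ := FiberBundle.exists_contMDiffOn_extend (k := ∞) 𝓘(ℝ, E) E z
    refine ⟨FiberBundle.extend E z, ?_, by simp⟩
    filter_upwards [eventually_mem_nhds_iff.2 hs] with y hy using hZs.contMDiffAt hy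
  have hZx := hZ.self_of_nhds
  have hjacobi := leibniz_identity_mlieBracket_apply (hsmooth (hV x)) (hsmooth (hW x))
    (hsmooth hZx)
  have hjacobi_smul : mlieBracket 𝓘(ℝ, E) V (mlieBracket 𝓘(ℝ, E) W (f • Z)) x =
      mlieBracket 𝓘(ℝ, E) (mlieBracket 𝓘(ℝ, E) V W) (f • Z) x +
        mlieBracket 𝓘(ℝ, E) W (mlieBracket 𝓘(ℝ, E) V (f • Z)) x :=
    leibniz_identity_mlieBracket_apply (hsmooth (hV x)) (hsmooth (hW x))
      (hsmooth ((hf x).smul_section hZx))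
  rw [mlieBracket_mlieBracket_smul hf hW hZ, mlieBracket_mlieBracket_smul hf hV hZ,
    mlieBracket_smul_right (hf.mdifferentiable (by simp) x) (hZx.mdifferentiableAt (by simp)),
    hjacobi, ← diff_eq_mvfderiv] at hjacobi_smul
  rw [sub_smul, eq_sub_iff_add_eq, ← sub_eq_zero, ← sub_eq_zero.2 hjacobi_smul.symm, smul_add]
  abel

theorem diff_mlieBracket [CompleteSpace E] {f : M → ℝ} {V W : ∀ x : M, TangentSpace 𝓘(ℝ, E) x}
    (hf : CMDiff ∞ f) (hV : CMDiff ∞ (T% V)) (hW : CMDiff ∞ (T% W)) (x : M) :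
    diff f x (mlieBracket 𝓘(ℝ, E) V W x) =
      diff (fun y => diff f y (W y)) x (V x) - diff (fun y => diff f y (V y)) x (W x) := by
  rcases subsingleton_or_nontrivial (TangentSpace 𝓘(ℝ, E) x) with hE | hE
  · simp only [Subsingleton.elim _ (0 : TangentSpace 𝓘(ℝ, E) x), map_zero, sub_zero]
  · obtain ⟨z, hz⟩ := exists_ne (0 : TangentSpace 𝓘(ℝ, E) x)
    exact smul_left_injective ℝ hz (diff_mlieBracket_smul hf hV hW z)

theorem exists_diff_eq [FiniteDimensional ℝ E] [T2Space M] (x : M)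
    (l : TangentSpace 𝓘(ℝ, E) x →L[ℝ] ℝ) :
    ∃ f : C^∞⟮𝓘(ℝ, E), M; ℝ⟯, diff f x = l := by
  let χ : SmoothBumpFunction 𝓘(ℝ, E) x := Classical.arbitrary _
  let l' : E →L[ℝ] ℝ := l
  have hl' : ContMDiffOn 𝓘(ℝ, E) 𝓘(ℝ, ℝ) ∞ (l' ∘ extChartAt 𝓘(ℝ, E) x) (chartAt E x).source :=
    l'.contMDiff.comp_contMDiffOn contMDiffOn_extChartAt
  refine ⟨⟨_, χ.contMDiff_smul hl'⟩, ?_⟩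
  have heq : (fun y => χ y • (l' ∘ extChartAt 𝓘(ℝ, E) x) y) =ᶠ[𝓝 x]
      l' ∘ extChartAt 𝓘(ℝ, E) x := by
    filter_upwards [χ.eventuallyEq_one] with y hy
    simp [hy]
  refine heq.mfderiv_eq.trans ?_
  rw [mfderiv_comp (I' := 𝓘(ℝ, E)) x l'.mdifferentiableAt
    (mdifferentiableAt_extChartAt (mem_chart_source E x)), mfderiv_extChartAt_self, l'.mfderiv_eq]
  rfl

theorem eq_of_forall_diff_eq [FiniteDimensional ℝ E] [T2Space M] {x : M}
    {v w : TangentSpace 𝓘(ℝ, E) x} (h : ∀ f : C^∞⟮𝓘(ℝ, E), M; ℝ⟯, diff f x v = diff f x w) :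
    v = w := by
  refine SeparatingDual.eq_iff_forall_dual_eq (R := ℝ) (V := E) |>.2 fun l => ?_
  obtain ⟨f, hf⟩ := exists_diff_eq x l
  have hfvw := h f
  rwa [hf] at hfvw

end Manifold

section Symbols

variable {E : Type*} [NormedAddCommGroup E] [NormedSpace ℝ E]
  {K : Type*} [TopologicalSpace K] [ChartedSpace E K] [IsManifold 𝓘(ℝ, E) ∞ K]
  {F : Type*} [NormedAddCommGroup F] [NormedSpace ℝ F]
  {V : K → Type*} [TopologicalSpace (TotalSpace F V)]
  [∀ k, AddCommGroup (V k)] [∀ k, Module ℝ (V k)] [∀ k, TopologicalSpace (V k)]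
  [FiberBundle F V] [VectorBundle ℝ F V]

/-- The Lie bracket of smooth vector fields, as a smooth vector field. -/
noncomputable def SmoothVectorField.lieBracket [CompleteSpace E] (X Y : SmoothVectorField E K) :
    SmoothVectorField E K :=
  ⟨mlieBracket 𝓘(ℝ, E) X Y, fun k => contMDiffAt_mlieBracket (X.contMDiff k) (Y.contMDiff k)⟩

/-- The derivation `f ↦ X(f)` of the smooth functions given by a vector field. -/
noncomputable def SmoothVectorField.derivation (X : SmoothVectorField E K)
    (f : C^∞⟮𝓘(ℝ, E), K; ℝ⟯) : C^∞⟮𝓘(ℝ, E), K; ℝ⟯ :=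
  ⟨fun k => diff f k (X k), contMDiff_diff_apply f.contMDiff X.contMDiff⟩

theorem exists_section_eq [FiniteDimensional ℝ E] [T2Space K] [ContMDiffVectorBundle ∞ F V 𝓘(ℝ, E)]
    {k : K} (v : V k) : ∃ h : Cₛ^∞⟮𝓘(ℝ, E); F, V⟯, h k = v := by
  obtain ⟨s, hs, hσ⟩ := FiberBundle.exists_contMDiffOn_extend (k := ∞) 𝓘(ℝ, E) F v
  obtain ⟨χ, -, hχ⟩ := (SmoothBumpFunction.nhds_basis_tsupport (I := 𝓘(ℝ, E)) k).mem_iff.1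
    (interior_mem_nhds.2 hs)
  refine ⟨⟨_, ContMDiffOn.smul_section_of_tsupport χ.contMDiff.contMDiffOn isOpen_interior hχ
    (hσ.mono interior_subset)⟩, ?_⟩
  change χ k • FiberBundle.extend F v k = v
  rw [χ.eq_one, one_smul, FiberBundle.extend_apply_self]

theorem exists_section_ne_zero [FiniteDimensional ℝ E] [T2Space K] [Nontrivial F]
    [ContMDiffVectorBundle ∞ F V 𝓘(ℝ, E)] (k : K) : ∃ h : Cₛ^∞⟮𝓘(ℝ, E); F, V⟯, h k ≠ 0 := by
  have : Nontrivial (V k) := ((trivializationAt F V k).continuousLinearEquivAt ℝ k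
    (FiberBundle.mem_baseSet_trivializationAt F V k)).toEquiv.nontrivial
  obtain ⟨v, hv⟩ := exists_ne (0 : V k)
  obtain ⟨h, rfl⟩ := exists_section_eq (E := E) (F := F) v
  exact ⟨h, hv⟩

namespace IsSymbol

variable {D : Cₛ^∞⟮𝓘(ℝ, E); F, V⟯ → Cₛ^∞⟮𝓘(ℝ, E); F, V⟯} {X X₁ X₂ : SmoothVectorField E K}

theorem unique [FiniteDimensional ℝ E] [T2Space K] [Nontrivial F]
    [ContMDiffVectorBundle ∞ F V 𝓘(ℝ, E)] (hX₁ : IsSymbol D X₁) (hX₂ : IsSymbol D X₂) :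
    X₁ = X₂ := by
  refine ContMDiffSection.ext fun k => eq_of_forall_diff_eq fun f => ?_
  obtain ⟨h, hh⟩ := exists_section_ne_zero (E := E) (F := F) (V := V) k
  exact smul_left_injective ℝ hh (add_left_cancel ((hX₁ f h k).symm.trans (hX₂ f h k)))

theorem neg (hD : IsSymbol D X) : IsSymbol (fun h => -D h) (-X) := by
  intro f h k
  have hneg : diff f k ((-X) k) = -diff f k (X k) := map_neg (diff f k) (X k)
  change -D (smulSection f h) k = f k • -D h k + diff f k ((-X) k) • h k
  rw [hD f h k, hneg, smul_neg, neg_smul, neg_add]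

theorem apply_smulSection (hD : IsSymbol D X) (f : C^∞⟮𝓘(ℝ, E), K; ℝ⟯)
    (h : Cₛ^∞⟮𝓘(ℝ, E); F, V⟯) :
    D (smulSection f h) = smulSection f (D h) + smulSection (X.derivation f) h :=
  ContMDiffSection.ext fun k => hD f h k

theorem commutator [CompleteSpace E]
    {D₁ D₂ : Cₛ^∞⟮𝓘(ℝ, E); F, V⟯ →ₗ[ℝ] Cₛ^∞⟮𝓘(ℝ, E); F, V⟯}
    (h₁ : IsSymbol D₁ X₁) (h₂ : IsSymbol D₂ X₂) :
    IsSymbol (fun h => D₁ (D₂ h) - D₂ (D₁ h)) (X₁.lieBracket X₂) := by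
  intro f h k
  simp only [h₁.apply_smulSection, h₂.apply_smulSection, map_add]
  change f k • D₁ (D₂ h) k + diff f k (X₁ k) • D₂ h k +
      (diff f k (X₂ k) • D₁ h k + diff (fun y => diff f y (X₂ y)) k (X₁ k) • h k) -
    (f k • D₂ (D₁ h) k + diff f k (X₂ k) • D₁ h k +
      (diff f k (X₁ k) • D₂ h k + diff (fun y => diff f y (X₁ y)) k (X₂ k) • h k)) =
    f k • (D₁ (D₂ h) k - D₂ (D₁ h) k) + diff f k (mlieBracket 𝓘(ℝ, E) X₁ X₂ k) • h k
  rw [diff_mlieBracket f.contMDiff X₁.contMDiff X₂.contMDiff, smul_sub, sub_smul]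
  abel

end IsSymbol

namespace KirillovBracket

variable (κ : KirillovBracket E F V)

theorem isSymbol_symbol (h : Cₛ^∞⟮𝓘(ℝ, E); F, V⟯) :
    IsSymbol (fun h₁ => κ.bracket h₁ h) (κ.symbol h) :=
  (κ.exists_symbol h).choose_spec

theorem bracket_swap (h₁ h₂ : Cₛ^∞⟮𝓘(ℝ, E); F, V⟯) : κ.bracket h₁ h₂ = -κ.bracket h₂ h₁ :=
  (LinearMap.IsAlt.neg κ.bracket_self h₂ h₁).symm

theorem isSymbol_neg_symbol (h : Cₛ^∞⟮𝓘(ℝ, E); F, V⟯) :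
    IsSymbol (fun h₁ => κ.bracket h h₁) (-κ.symbol h) := by
  simpa only [← κ.bracket_swap h] using (κ.isSymbol_symbol h).neg

theorem bracket_bracket_sub (h h₁ h₂ : Cₛ^∞⟮𝓘(ℝ, E); F, V⟯) :
    κ.bracket (κ.bracket h h₂) h₁ - κ.bracket (κ.bracket h h₁) h₂ =
      -κ.bracket h (κ.bracket h₁ h₂) := by
  have hjacobi := κ.jacobi h h₁ h₂
  rw [κ.bracket_swap _ h, κ.bracket_swap h₂ h, map_neg, LinearMap.neg_apply] at hjacobi
  rw [eq_comm, ← sub_eq_zero, ← hjacobi]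
  abel

@[ext]
theorem ext {κ₁ κ₂ : KirillovBracket E F V}
    (h : ∀ h₁ h₂, κ₁.bracket h₁ h₂ = κ₂.bracket h₁ h₂) : κ₁ = κ₂ := by
  have : κ₁.bracket = κ₂.bracket := LinearMap.ext₂ h
  cases κ₁
  cases κ₂
  cases this
  rfl

variable [FiniteDimensional ℝ E] [T2Space K] [Nontrivial F] [ContMDiffVectorBundle ∞ F V 𝓘(ℝ, E)]

theorem isSymbol_iff_eq_symbol {h : Cₛ^∞⟮𝓘(ℝ, E); F, V⟯} {X : SmoothVectorField E K} :
    IsSymbol (fun h₁ => κ.bracket h₁ h) X ↔ X = κ.symbol h :=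
  ⟨fun hX => hX.unique (κ.isSymbol_symbol h), fun hX => hX ▸ κ.isSymbol_symbol h⟩

theorem mlieBracket_symbol (h₁ h₂ : Cₛ^∞⟮𝓘(ℝ, E); F, V⟯) (k : K) :
    mlieBracket 𝓘(ℝ, E) (κ.symbol h₁) (κ.symbol h₂) k = -κ.symbol (κ.bracket h₁ h₂) k := by
  have := FiniteDimensional.complete ℝ E
  have hcomm := IsSymbol.commutator (D₁ := κ.bracket.flip h₁) (D₂ := κ.bracket.flip h₂)
    (κ.isSymbol_symbol h₁) (κ.isSymbol_symbol h₂)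
  simp only [LinearMap.flip_apply, κ.bracket_bracket_sub] at hcomm
  exact DFunLike.congr_fun (hcomm.unique (κ.isSymbol_symbol _).neg) k

end KirillovBracket
end Symbols

namespace Bivector

variable {E : Type*} [NormedAddCommGroup E] [NormedSpace ℝ E]
  {P : Type*} [TopologicalSpace P] [ChartedSpace E P] [IsManifold 𝓘(ℝ, E) ∞ P]
  (Λ : Bivector E P)

theorem contMDiff_hamiltonian {H : P → ℝ} (hH : CMDiff ∞ H) : CMDiff ∞ (T% (Λ.hamiltonian H)) :=
  (Λ.contMDiff_sharp.clm_bundle_apply (contMDiff_diff hH)).neg_section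

theorem poissonBracket_eq_diff_hamiltonian (F H : P → ℝ) (x : P) :
    Λ.poissonBracket F H x = diff F x (Λ.hamiltonian H x) := by
  rw [poissonBracket, eval, Λ.skew, hamiltonian, map_neg]

theorem contMDiff_poissonBracket {F H : P → ℝ} (hF : CMDiff ∞ F) (hH : CMDiff ∞ H) :
    CMDiff ∞ (Λ.poissonBracket F H) :=
  (contMDiff_diff_apply hF (Λ.contMDiff_hamiltonian hH)).congr
    fun x => Λ.poissonBracket_eq_diff_hamiltonian F H x

theorem poissonBracket_swap (F H : P → ℝ) : Λ.poissonBracket F H = -Λ.poissonBracket H F :=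
  funext fun x => Λ.skew x _ _

theorem poissonBracket_self (F : P → ℝ) : Λ.poissonBracket F F = 0 :=
  self_eq_neg.1 (Λ.poissonBracket_swap F F)

section Left

variable {F F₁ F₂ : P → ℝ} (H : P → ℝ)

theorem poissonBracket_add_left (hF₁ : MDiff F₁) (hF₂ : MDiff F₂) :
    Λ.poissonBracket (F₁ + F₂) H = Λ.poissonBracket F₁ H + Λ.poissonBracket F₂ H := by
  ext x
  simp only [poissonBracket_eq_diff_hamiltonian, Pi.add_apply, diff_eq_mvfderiv,
    mvfderiv_add (hF₁ x) (hF₂ x), add_apply]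

theorem poissonBracket_smul_left (c : ℝ) (hF : MDiff F) :
    Λ.poissonBracket (c • F) H = c • Λ.poissonBracket F H := by
  ext x
  have hdiff : diff (E := E) (c • F) x = c • diff F x := const_smul_mfderiv (hF x) c
  simp only [poissonBracket_eq_diff_hamiltonian, Pi.smul_apply, hdiff, smul_apply]

theorem poissonBracket_neg_left (F : P → ℝ) :
    Λ.poissonBracket (-F) H = -Λ.poissonBracket F H := by
  ext x
  simp only [poissonBracket_eq_diff_hamiltonian, Pi.neg_apply, diff_eq_mvfderiv, mvfderiv_neg,
    neg_apply]

theorem poissonBracket_mul_left (hF₁ : MDiff F₁) (hF₂ : MDiff F₂) :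
    Λ.poissonBracket (F₁ * F₂) H = F₁ * Λ.poissonBracket F₂ H + Λ.poissonBracket F₁ H * F₂ := by
  ext x
  simp only [poissonBracket_eq_diff_hamiltonian, Pi.add_apply, Pi.mul_apply, diff_eq_mvfderiv,
    mvfderiv_mul (hF₁ x) (hF₂ x), add_apply, smul_apply, smul_eq_mul, mul_comm (F₂ x)]

end Left

section Right

variable (F : P → ℝ) {H H₁ H₂ : P → ℝ}

theorem poissonBracket_add_right (hH₁ : MDiff H₁) (hH₂ : MDiff H₂) :
    Λ.poissonBracket F (H₁ + H₂) = Λ.poissonBracket F H₁ + Λ.poissonBracket F H₂ := by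
  rw [poissonBracket_swap, poissonBracket_add_left Λ F hH₁ hH₂, neg_add, ← poissonBracket_swap,
    ← poissonBracket_swap]

theorem poissonBracket_smul_right (c : ℝ) (hH : MDiff H) :
    Λ.poissonBracket F (c • H) = c • Λ.poissonBracket F H := by
  rw [poissonBracket_swap, poissonBracket_smul_left Λ F c hH, ← smul_neg, ← poissonBracket_swap]

end Right

namespace IsHomogeneous

variable {Λ} {G : OpenSubgroup ℝˣ} [MulAction G P] {F H : P → ℝ}

theorem poissonBracket_comp_smul (hG : Λ.IsHomogeneous G) (hF : MDiff F) (hH : MDiff H) {s : G}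
    (hs : MDiff (fun y : P => s • y)) (x : P) :
    Λ.poissonBracket (fun y => F (s • y)) (fun y => H (s • y)) x =
      scale s * Λ.poissonBracket F H (s • x) := by
  have hcomp {f : P → ℝ} (hf : MDiff f) : diff (E := E) (fun y => f (s • y)) x =
      (diff f (s • x)).comp (mfderiv 𝓘(ℝ, E) 𝓘(ℝ, E) (fun y : P => s • y) x) :=
    mfderiv_comp x (hf _) (hs x)
  rw [poissonBracket, hcomp hF, hcomp hH]
  exact hG s x _ _

theorem scale_mul_poissonBracket_smul (hG : Λ.IsHomogeneous G) (hF : MDiff F) (hH : MDiff H) {s : G}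
    (hs : MDiff (fun y : P => s • y)) {a b : ℝ} (hFs : ∀ x, F (s • x) = a * F x)
    (hHs : ∀ x, H (s • x) = b * H x) (x : P) :
    scale s * Λ.poissonBracket F H (s • x) = a * b * Λ.poissonBracket F H x := by
  have hFs' : (fun y => F (s • y)) = a • F := funext hFs
  have hHs' : (fun y => H (s • y)) = b • H := funext hHs
  rw [← hG.poissonBracket_comp_smul hF hH hs, hFs', hHs', Λ.poissonBracket_smul_left _ _ hF,
    Λ.poissonBracket_smul_right _ _ hH, smul_smul, Pi.smul_apply, smul_eq_mul]

theorem poissonBracket_mem_homogeneousFunctions (hG : Λ.IsHomogeneous G)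
    (hs : ∀ s : G, MDiff (fun y : P => s • y))
    (hF : F ∈ homogeneousFunctions E P G) (hH : H ∈ homogeneousFunctions E P G) :
    Λ.poissonBracket F H ∈ homogeneousFunctions E P G := by
  refine ⟨Λ.contMDiff_poissonBracket hF.1 hH.1, fun s x => mul_left_cancel₀ (scale_ne_zero s) ?_⟩
  rw [hG.scale_mul_poissonBracket_smul (hF.1.mdifferentiable (by simp))
    (hH.1.mdifferentiable (by simp)) (hs s) (hF.2 s) (hH.2 s), mul_assoc]

theorem poissonBracket_smul_of_invariant (hG : Λ.IsHomogeneous G)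
    (hs : ∀ s : G, MDiff (fun y : P => s • y))
    (hF : MDiff F) (hFs : ∀ (s : G) (x : P), F (s • x) = F x)
    (hH : H ∈ homogeneousFunctions E P G) (s : G) (x : P) :
    Λ.poissonBracket F H (s • x) = Λ.poissonBracket F H x := by
  refine mul_left_cancel₀ (scale_ne_zero s) ?_
  rw [hG.scale_mul_poissonBracket_smul hF (hH.1.mdifferentiable (by simp)) (hs s)
    (a := 1) (by simpa only [one_mul] using hFs s) (hH.2 s), one_mul]

end IsHomogeneous

end Bivector

namespace ScalingBundle

variable {G : OpenSubgroup ℝˣ}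
  {EP : Type*} [NormedAddCommGroup EP] [NormedSpace ℝ EP]
  {P : Type*} [TopologicalSpace P] [ChartedSpace EP P] [MulAction G P]
  {EK : Type*} [NormedAddCommGroup EK] [NormedSpace ℝ EK]
  {K : Type*} [TopologicalSpace K] [ChartedSpace EK K]
  {B : ScalingBundle G EP P EK K}

namespace Triv

variable (T : B.Triv)

/-- The local section of the principal bundle on which `τ = 1`. -/
noncomputable def sec (k : K) : P := T.e.toOpenPartialHomeomorph.symm (k, 1)

theorem proj_sec {k : K} (hk : k ∈ T.e.baseSet) : B.proj (T.sec k) = k :=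
  T.e.proj_symm_apply' hk

theorem tau_sec {k : K} (hk : k ∈ T.e.baseSet) : T.tau (T.sec k) = 1 := by
  rw [tau, sec, T.e.apply_symm_apply' hk, scale_one]

theorem contMDiffOn_sec : CMDiff[T.e.baseSet] ∞ T.sec :=
  T.smooth_symm.comp (contMDiff_id.prodMk contMDiff_const).contMDiffOn
    fun k hk => by rw [T.e.target_eq]; exact ⟨hk, mem_univ _⟩

theorem contMDiffOn_tau : CMDiff[T.e.source] ∞ T.tau :=
  (contMDiff_scale.comp contMDiff_snd).comp_contMDiffOn T.smooth

theorem lineTriv_symm_one {k : K} (hk : k ∈ T.e.baseSet) :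
    T.lineTriv.symm k 1 = B.fiberMk ⟨T.sec k, T.proj_sec hk⟩ 1 := by
  have hmk : ∀ (x : P) (hx : B.proj x = k), T.tau x = 1 →
      T.lineTriv ⟨k, B.fiberMk ⟨x, hx⟩ 1⟩ = (k, 1) := by
    rintro x rfl hτ
    exact (T.lineTriv_mk hk 1).trans (by rw [hτ, mul_one])
  have := T.lineTriv.symm_proj_apply ⟨k, B.fiberMk ⟨T.sec k, T.proj_sec hk⟩ 1⟩ hk
  rwa [hmk _ _ (T.tau_sec hk)] at this

end Triv

variable (B)

theorem contMDiff_const_smul (B : ScalingBundle G EP P EK K) (s : G) :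
    CMDiff ∞ (fun x : P => s • x) :=
  B.contMDiff_smul.comp (contMDiff_const.prodMk contMDiff_id)

theorem mdifferentiable_const_smul (B : ScalingBundle G EP P EK K) (s : G) :
    MDiff (fun x : P => s • x) :=
  (B.contMDiff_const_smul s).mdifferentiable (by simp)

theorem contMDiff_proj : CMDiff ∞ B.proj := by
  intro x
  obtain ⟨T, hT⟩ := B.exists_triv (B.proj x)
  have hnhds := T.e.open_source.mem_nhds (T.e.mem_source.2 hT)
  refine (contMDiffAt_fst.comp x (T.smooth.contMDiffAt hnhds)).congr_of_eventuallyEq ?_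
  filter_upwards [hnhds] with y hy using (T.e.coe_fst hy).symm

theorem contMDiff_lineMk (t : ℝ) : ContMDiff 𝓘(ℝ, EP) (𝓘(ℝ, EK).prod 𝓘(ℝ, ℝ)) ∞
    (fun x => TotalSpace.mk' ℝ (E := B.LineFiber) (B.proj x) (B.lineMk x t)) := by
  intro x
  rw [contMDiffAt_totalSpace]
  refine ⟨B.contMDiff_proj x, ?_⟩
  set T := (B.exists_triv (B.proj x)).choose
  have hT : B.proj x ∈ T.e.baseSet := (B.exists_triv (B.proj x)).choose_spec
  have hnhds := T.e.open_source.mem_nhds (T.e.mem_source.2 hT)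
  have hτ : CMDiffAt ∞ (fun y => t * T.tau y) x :=
    contMDiffAt_const.mul (T.contMDiffOn_tau.contMDiffAt hnhds)
  refine hτ.congr_of_eventuallyEq ?_
  filter_upwards [hnhds] with y hy
  exact congrArg Prod.snd (T.lineTriv_mk (T.e.mem_source.1 hy) t)

theorem contMDiff_homFun (h : B.DualSection) : CMDiff ∞ (B.homFun h) :=
  fun x => (contMDiffAt_totalSpace.1
    ((h.contMDiff.comp B.contMDiff_proj).clm_bundle_apply (B.contMDiff_lineMk 1) x)).2

theorem mdifferentiable_homFun (h : B.DualSection) : MDiff (B.homFun h) :=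
  (B.contMDiff_homFun h).mdifferentiable (by simp)

theorem apply_fiberMk (h : B.DualSection) {k : K} (x : {x : P // B.proj x = k}) (t : ℝ) :
    h k (B.fiberMk x t) = t * B.homFun h x := by
  obtain ⟨x, rfl⟩ := x
  rw [← mul_one t, ← B.smul_fiberMk, mul_one]
  exact map_smul (h (B.proj x)) t (B.lineMk x 1)

theorem homFun_mem_homogeneousFunctions (h : B.DualSection) :
    B.homFun h ∈ homogeneousFunctions EP P G := by
  refine ⟨B.contMDiff_homFun h, fun s x => ?_⟩
  rw [← one_mul (B.homFun h (s • x)), ← B.apply_fiberMk h ⟨s • x, B.proj_smul s x⟩,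
    B.fiberMk_smul (x := ⟨x, rfl⟩) rfl, mul_one, B.apply_fiberMk]

theorem homFun_injective : Function.Injective B.homFun := by
  intro h₁ h₂ h
  ext k l
  obtain ⟨t, rfl⟩ := (B.fiberMk_bijective (B.pt k)).2 l
  rw [B.apply_fiberMk, B.apply_fiberMk, h]

/-- The section `k ↦ ([x, t] ↦ t H(x))` of `L^*` given by a homogeneous function `H`, before its
smoothness is known. Its value over `k` is computed at the chosen point `pt k`. -/
noncomputable def dualFun (H : P → ℝ) (k : K) : B.DualFiber k where
  toLinearMap := H (B.pt k) • (B.fiberLinearEquiv k).toLinearMap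
  cont := (continuous_induced_dom (f := B.fiberEquiv k)).const_smul (H (B.pt k))

theorem dualFun_fiberMk {H : P → ℝ} (hH : ∀ (s : G) (x : P), H (s • x) = scale s * H x) {k : K}
    (x : {x : P // B.proj x = k}) (t : ℝ) : B.dualFun H k (B.fiberMk x t) = t * H x := by
  obtain ⟨s, hs⟩ := B.exists_smul_eq ((B.pt k).2.trans x.2.symm)
  change H (B.pt k) * B.fiberLinearEquiv k (B.fiberMk x t) = t * H x
  rw [B.fiberLinearEquiv_fiberMk hs, hs, hH]
  ring

theorem contMDiff_dualFun {H : P → ℝ} (hH : H ∈ homogeneousFunctions EP P G) :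
    ContMDiff 𝓘(ℝ, EK) (𝓘(ℝ, EK).prod 𝓘(ℝ, ℝ →L[ℝ] ℝ)) ∞
      (fun k => TotalSpace.mk' (ℝ →L[ℝ] ℝ) (E := B.DualFiber) k (B.dualFun H k)) := by
  intro k
  rw [contMDiffAt_hom_bundle]
  refine ⟨contMDiffAt_id, ?_⟩
  set T := (B.exists_triv k).choose
  have hT : k ∈ T.e.baseSet := (B.exists_triv k).choose_spec
  have hnhds := T.e.open_baseSet.mem_nhds hT
  have hsec : CMDiffAt ∞ (fun y => H (T.sec y) • ContinuousLinearMap.id ℝ ℝ) k :=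
    ((hH.1.comp_contMDiffOn T.contMDiffOn_sec).contMDiffAt hnhds).smul contMDiffAt_const
  refine hsec.congr_of_eventuallyEq ?_
  filter_upwards [hnhds] with y hy
  have htriv : (trivializationAt ℝ (Bundle.Trivial K ℝ) k).continuousLinearMapAt ℝ y =
      ContinuousLinearMap.id ℝ ℝ := Bundle.Trivial.continuousLinearMapAt_trivialization ..
  have hone : (trivializationAt ℝ B.LineFiber k).symmL ℝ y 1 =
      B.fiberMk ⟨T.sec y, T.proj_sec hy⟩ 1 :=
    (Trivialization.symmL_apply _ hy _).trans (T.lineTriv_symm_one hy)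
  simp only [ContinuousLinearMap.inCoordinates]
  ext
  refine (DFunLike.congr_fun htriv _).trans ?_
  change B.dualFun H y ((trivializationAt ℝ B.LineFiber k).symmL ℝ y 1) = H (T.sec y) * 1
  rw [hone, B.dualFun_fiberMk hH.2, mul_comm]

/-- The section of `L^*` given by a homogeneous function, the inverse of `homFun`. -/
noncomputable def dualSection (H : P → ℝ) (hH : H ∈ homogeneousFunctions EP P G) : B.DualSection :=
  ⟨B.dualFun H, B.contMDiff_dualFun hH⟩

theorem homFun_dualSection {H : P → ℝ} (hH : H ∈ homogeneousFunctions EP P G) :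
    B.homFun (B.dualSection H hH) = H :=
  funext fun x => (B.dualFun_fiberMk hH.2 ⟨x, rfl⟩ 1).trans (one_mul _)

theorem bijOn_homFun : BijOn B.homFun univ (homogeneousFunctions EP P G) :=
  ⟨fun h _ => B.homFun_mem_homogeneousFunctions h, B.homFun_injective.injOn,
    fun _ hH => ⟨B.dualSection _ hH, mem_univ _, B.homFun_dualSection hH⟩⟩

theorem homFun_add (h₁ h₂ : B.DualSection) : B.homFun (h₁ + h₂) = B.homFun h₁ + B.homFun h₂ := rfl

theorem homFun_smul (c : ℝ) (h : B.DualSection) : B.homFun (c • h) = c • B.homFun h := rfl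

theorem homFun_neg (h : B.DualSection) : B.homFun (-h) = -B.homFun h := rfl

theorem homFun_zero : B.homFun 0 = 0 := rfl

theorem homFun_smulSection (f : C^∞⟮𝓘(ℝ, EK), K; ℝ⟯) (h : B.DualSection) :
    B.homFun (smulSection f h) = (f ∘ B.proj) * B.homFun h := rfl

theorem diff_comp_proj {f : K → ℝ} (hf : MDiff f) (x : P) (v : TangentSpace 𝓘(ℝ, EP) x) :
    diff (f ∘ B.proj) x v =
      diff f (B.proj x) (mfderiv 𝓘(ℝ, EP) 𝓘(ℝ, EK) B.proj x v) :=
  mfderiv_comp_apply x (hf _) (B.contMDiff_proj.mdifferentiable (by simp) x) v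

variable [IsManifold 𝓘(ℝ, EP) ∞ P]

section BracketSection

variable {Λ : Bivector EP P} (hG : Λ.IsHomogeneous G)

/-- The bracket `[h₁, h₂]` of sections of `L^*` determined by `H_{[h₁, h₂]} = -{H_{h₁}, H_{h₂}}`. -/
noncomputable def bracketSection (h₁ h₂ : B.DualSection) : B.DualSection :=
  -B.dualSection (Λ.poissonBracket (B.homFun h₁) (B.homFun h₂))
    (hG.poissonBracket_mem_homogeneousFunctions B.mdifferentiable_const_smul
      (B.homFun_mem_homogeneousFunctions h₁) (B.homFun_mem_homogeneousFunctions h₂))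

theorem homFun_bracketSection (h₁ h₂ : B.DualSection) :
    B.homFun (B.bracketSection hG h₁ h₂) = -Λ.poissonBracket (B.homFun h₁) (B.homFun h₂) := by
  rw [bracketSection, homFun_neg, homFun_dualSection]

theorem bracketSection_self (h : B.DualSection) : B.bracketSection hG h h = 0 :=
  B.homFun_injective <| by
    rw [homFun_bracketSection, Λ.poissonBracket_self, neg_zero, homFun_zero]

theorem bracketSection_jacobi (hΛ : Λ.IsPoisson) (h₁ h₂ h₃ : B.DualSection) :
    B.bracketSection hG (B.bracketSection hG h₁ h₂) h₃ +
      B.bracketSection hG (B.bracketSection hG h₂ h₃) h₁ +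
      B.bracketSection hG (B.bracketSection hG h₃ h₁) h₂ = 0 := by
  refine B.homFun_injective ?_
  simp only [homFun_add, homFun_bracketSection, Λ.poissonBracket_neg_left, neg_neg, homFun_zero]
  exact funext (hΛ ⟨_, B.contMDiff_homFun h₁⟩ ⟨_, B.contMDiff_homFun h₂⟩
    ⟨_, B.contMDiff_homFun h₃⟩)

/-- The bracket of sections of `L^*` as a bilinear map. -/
noncomputable def bracketLinearMap : B.DualSection →ₗ[ℝ] B.DualSection →ₗ[ℝ] B.DualSection :=
  LinearMap.mk₂ ℝ (B.bracketSection hG)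
    (fun h₁ h₂ _ => B.homFun_injective <| by
      simp only [homFun_add, homFun_bracketSection, neg_add, Λ.poissonBracket_add_left _
        (B.mdifferentiable_homFun h₁) (B.mdifferentiable_homFun h₂)])
    (fun _ h _ => B.homFun_injective <| by
      simp only [homFun_smul, homFun_bracketSection, smul_neg,
        Λ.poissonBracket_smul_left _ _ (B.mdifferentiable_homFun h)])
    (fun _ h₁ h₂ => B.homFun_injective <| by
      simp only [homFun_add, homFun_bracketSection, neg_add, Λ.poissonBracket_add_right _
        (B.mdifferentiable_homFun h₁) (B.mdifferentiable_homFun h₂)])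
    (fun _ _ h => B.homFun_injective <| by
      simp only [homFun_smul, homFun_bracketSection, smul_neg,
        Λ.poissonBracket_smul_right _ _ (B.mdifferentiable_homFun h)])

end BracketSection

variable [IsManifold 𝓘(ℝ, EK) ∞ K]

section Projection

variable {V : ∀ x : P, TangentSpace 𝓘(ℝ, EP) x}

theorem contMDiff_of_mfderiv_proj_eq {X : ∀ k : K, TangentSpace 𝓘(ℝ, EK) k}
    (hV : CMDiff ∞ (T% V))
    (hX : ∀ x, mfderiv 𝓘(ℝ, EP) 𝓘(ℝ, EK) B.proj x (V x) = X (B.proj x)) :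
    CMDiff ∞ (T% X) := by
  intro k
  obtain ⟨T, hT⟩ := B.exists_triv k
  have hnhds := T.e.open_baseSet.mem_nhds hT
  have hsec := ((B.contMDiff_proj.contMDiff_tangentMap (m := ∞) (by simp)).comp hV).comp_contMDiffOn
    T.contMDiffOn_sec
  refine (hsec.contMDiffAt hnhds).congr_of_eventuallyEq ?_
  filter_upwards [hnhds] with y hy
  have hpush : (T% X) (B.proj (T.sec y)) =
      tangentMap 𝓘(ℝ, EP) 𝓘(ℝ, EK) B.proj ((T% V) (T.sec y)) := by
    rw [tangentMap, hX]
  rwa [T.proj_sec hy] at hpush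

theorem exists_projection [FiniteDimensional ℝ EK] [T2Space K] (hV : CMDiff ∞ (T% V))
    (hinv : ∀ (f : C^∞⟮𝓘(ℝ, EK), K; ℝ⟯) (s : G) (x : P),
      diff (f ∘ B.proj) (s • x) (V (s • x)) = diff (f ∘ B.proj) x (V x)) :
    ∃ X : SmoothVectorField EK K,
      ∀ x, mfderiv 𝓘(ℝ, EP) 𝓘(ℝ, EK) B.proj x (V x) = X (B.proj x) := by
  have hfib {x y : P} (hxy : B.proj y = B.proj x) :
      mfderiv 𝓘(ℝ, EP) 𝓘(ℝ, EK) B.proj x (V x) =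
        (mfderiv 𝓘(ℝ, EP) 𝓘(ℝ, EK) B.proj y (V y) : EK) := by
    obtain ⟨s, rfl⟩ := B.exists_smul_eq hxy.symm
    refine eq_of_forall_diff_eq (x := B.proj x) fun f => ?_
    have hf := f.contMDiff.mdifferentiable (by simp)
    rw [← B.diff_comp_proj hf, ← hinv f s x, B.diff_comp_proj hf, hxy]
  let X (k : K) : TangentSpace 𝓘(ℝ, EK) k :=
    (mfderiv 𝓘(ℝ, EP) 𝓘(ℝ, EK) B.proj (B.pt k) (V (B.pt k)) : EK)
  have hX (x : P) : mfderiv 𝓘(ℝ, EP) 𝓘(ℝ, EK) B.proj x (V x) = X (B.proj x) :=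
    hfib (B.pt (B.proj x)).2
  exact ⟨⟨X, B.contMDiff_of_mfderiv_proj_eq hV hX⟩, hX⟩

end Projection

section Poisson

variable {Λ : Bivector EP P}

theorem exists_projection_hamiltonian [FiniteDimensional ℝ EK] [T2Space K]
    (hG : Λ.IsHomogeneous G) {H : P → ℝ} (hH : H ∈ homogeneousFunctions EP P G) :
    ∃ X : SmoothVectorField EK K,
      ∀ x, mfderiv 𝓘(ℝ, EP) 𝓘(ℝ, EK) B.proj x (Λ.hamiltonian H x) = X (B.proj x) := by
  refine B.exists_projection (Λ.contMDiff_hamiltonian hH.1) fun f s x => ?_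
  simp only [← Λ.poissonBracket_eq_diff_hamiltonian]
  exact hG.poissonBracket_smul_of_invariant B.mdifferentiable_const_smul
    ((f.contMDiff.comp B.contMDiff_proj).mdifferentiable (by simp))
    (fun s y => congrArg f (B.proj_smul s y)) hH s x

theorem isSymbol_neg_projection {h : B.DualSection} {D : B.DualSection → B.DualSection}
    (hD : ∀ h₁, Λ.poissonBracket (B.homFun h₁) (B.homFun h) = -B.homFun (D h₁))
    {X : SmoothVectorField EK K}
    (hX : ∀ x, mfderiv 𝓘(ℝ, EP) 𝓘(ℝ, EK) B.proj x (Λ.hamiltonian (B.homFun h) x) =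
      X (B.proj x)) : IsSymbol D (-X) := by
  intro f h₁ k
  suffices hleibniz : D (smulSection f h₁) =
      smulSection f (D h₁) + smulSection ((-X).derivation f) h₁ from
    DFunLike.congr_fun hleibniz k
  have hXf : Λ.poissonBracket (f ∘ B.proj) (B.homFun h) = -((-X).derivation f ∘ B.proj) := by
    ext x
    rw [Λ.poissonBracket_eq_diff_hamiltonian,
      B.diff_comp_proj (f.contMDiff.mdifferentiable (by simp)), hX, ← neg_neg (X (B.proj x)),
      map_neg]
    rfl
  refine B.homFun_injective (neg_injective ?_)
  rw [← hD, B.homFun_smulSection, Λ.poissonBracket_mul_left _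
    ((f.contMDiff.comp B.contMDiff_proj).mdifferentiable (by simp))
    (B.mdifferentiable_homFun h₁), hD, hXf, B.homFun_add,
    B.homFun_smulSection, B.homFun_smulSection]
  ring

theorem mfderiv_proj_hamiltonian_homFun [FiniteDimensional ℝ EK] [T2Space K]
    (hG : Λ.IsHomogeneous G) {κ : KirillovBracket EK (ℝ →L[ℝ] ℝ) B.DualFiber} {h : B.DualSection}
    (hκ : ∀ h₁, Λ.poissonBracket (B.homFun h₁) (B.homFun h) = -B.homFun (κ.bracket h₁ h))
    (x : P) : mfderiv 𝓘(ℝ, EP) 𝓘(ℝ, EK) B.proj x (Λ.hamiltonian (B.homFun h) x) =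
      -κ.symbol h (B.proj x) := by
  obtain ⟨X, hX⟩ := B.exists_projection_hamiltonian hG (B.homFun_mem_homogeneousFunctions h)
  rw [hX, ← κ.isSymbol_iff_eq_symbol.1 (B.isSymbol_neg_projection hκ hX)]
  exact (neg_neg (X (B.proj x))).symm

/-- The Kirillov bracket on the sections of `L^*` induced by a homogeneous Poisson structure. -/
noncomputable def kirillovBracket [FiniteDimensional ℝ EK] [T2Space K] (hΛ : Λ.IsPoisson)
    (hG : Λ.IsHomogeneous G) : KirillovBracket EK (ℝ →L[ℝ] ℝ) B.DualFiber where
  bracket := B.bracketLinearMap hG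
  bracket_self := B.bracketSection_self hG
  jacobi := B.bracketSection_jacobi hG hΛ
  exists_symbol h := by
    obtain ⟨X, hX⟩ := B.exists_projection_hamiltonian hG (B.homFun_mem_homogeneousFunctions h)
    exact ⟨-X, B.isSymbol_neg_projection
      (fun h₁ => (neg_eq_iff_eq_neg.2 (B.homFun_bracketSection hG h₁ h)).symm) hX⟩

theorem poissonBracket_eq_neg_homFun_kirillovBracket [FiniteDimensional ℝ EK] [T2Space K]
    (hΛ : Λ.IsPoisson) (hG : Λ.IsHomogeneous G) (h₁ h₂ : B.DualSection) :
    Λ.poissonBracket (B.homFun h₁) (B.homFun h₂) =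
      -B.homFun ((B.kirillovBracket hΛ hG).bracket h₁ h₂) :=
  (neg_eq_iff_eq_neg.2 (B.homFun_bracketSection hG h₁ h₂)).symm

theorem eq_kirillovBracket [FiniteDimensional ℝ EK] [T2Space K] (hΛ : Λ.IsPoisson)
    (hG : Λ.IsHomogeneous G) {κ : KirillovBracket EK (ℝ →L[ℝ] ℝ) B.DualFiber}
    (hκ : ∀ h₁ h₂, Λ.poissonBracket (B.homFun h₁) (B.homFun h₂) =
      -B.homFun (κ.bracket h₁ h₂)) : κ = B.kirillovBracket hΛ hG :=
  KirillovBracket.ext fun h₁ h₂ => B.homFun_injective <| neg_injective <|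
    (hκ h₁ h₂).symm.trans (B.poissonBracket_eq_neg_homFun_kirillovBracket hΛ hG h₁ h₂)

end Poisson

end ScalingBundle

end ScalingReduction

theorem mainTheorem1_general
    {EP : Type*} [NormedAddCommGroup EP] [NormedSpace ℝ EP]
    {P : Type*} [TopologicalSpace P] [ChartedSpace EP P] [IsManifold 𝓘(ℝ, EP) ∞ P]
    {EK : Type*} [NormedAddCommGroup EK] [NormedSpace ℝ EK] [FiniteDimensional ℝ EK]
    {K : Type*} [TopologicalSpace K] [T2Space K]
    [ChartedSpace EK K] [IsManifold 𝓘(ℝ, EK) ∞ K]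
    (G : OpenSubgroup ℝˣ) [MulAction G P] (B : ScalingBundle G EP P EK K)
    (Λ : Bivector EP P) (hΛ : Λ.IsPoisson) (hG : Λ.IsHomogeneous G) :
    Set.BijOn B.homFun Set.univ (homogeneousFunctions EP P G) ∧
    (∀ (h : B.DualSection) (x : P) (t : ℝ), h (B.proj x) (B.lineMk x t) = t * B.homFun h x) ∧
    (∃! κ : KirillovBracket EK (ℝ →L[ℝ] ℝ) B.DualFiber, ∀ h₁ h₂ : B.DualSection,
      Λ.poissonBracket (B.homFun h₁) (B.homFun h₂) = -B.homFun (κ.bracket h₁ h₂)) ∧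
    ∀ κ : KirillovBracket EK (ℝ →L[ℝ] ℝ) B.DualFiber,
      (∀ h₁ h₂ : B.DualSection,
        Λ.poissonBracket (B.homFun h₁) (B.homFun h₂) = -B.homFun (κ.bracket h₁ h₂)) →
      (∀ (h : B.DualSection) (X : SmoothVectorField EK K),
        IsSymbol (fun h₁ => κ.bracket h₁ h) X ↔ X = κ.symbol h) ∧
      (∀ h : B.DualSection, IsSymbol (fun h₁ => κ.bracket h h₁) (-κ.symbol h)) ∧
      (∀ (h : B.DualSection) (x : P),
        mfderiv 𝓘(ℝ, EP) 𝓘(ℝ, EK) B.proj x (Λ.hamiltonian (B.homFun h) x) =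
          -κ.symbol h (B.proj x)) ∧
      (∀ (h₁ h₂ : B.DualSection) (k : K),
        VectorField.mlieBracket 𝓘(ℝ, EK) (κ.symbol h₁) (κ.symbol h₂) k =
          -κ.symbol (κ.bracket h₁ h₂) k) := by
  refine ⟨B.bijOn_homFun, fun h x t => B.apply_fiberMk h ⟨x, rfl⟩ t,
    ⟨B.kirillovBracket hΛ hG, B.poissonBracket_eq_neg_homFun_kirillovBracket hΛ hG,
      fun κ hκ => B.eq_kirillovBracket hΛ hG hκ⟩, fun κ hκ => ⟨?_, ?_, ?_, ?_⟩⟩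
  · exact fun h X => κ.isSymbol_iff_eq_symbol
  · exact κ.isSymbol_neg_symbol
  · exact fun h => B.mfderiv_proj_hamiltonian_homFun hG fun h₁ => hκ h₁ h
  · exact κ.mlieBracket_symbol

theorem mainTheorem1
    {EP : Type*} [NormedAddCommGroup EP] [NormedSpace ℝ EP] [FiniteDimensional ℝ EP]
    {P : Type*} [TopologicalSpace P] [T2Space P] [SecondCountableTopology P]
    [ChartedSpace EP P] [IsManifold 𝓘(ℝ, EP) ∞ P]
    {EK : Type*} [NormedAddCommGroup EK] [NormedSpace ℝ EK] [FiniteDimensional ℝ EK]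
    {K : Type*} [TopologicalSpace K] [T2Space K] [SecondCountableTopology K]
    [ChartedSpace EK K] [IsManifold 𝓘(ℝ, EK) ∞ K]
    (G : OpenSubgroup ℝˣ) [MulAction G P] (B : ScalingBundle G EP P EK K)
    (Λ : Bivector EP P) (hΛ : Λ.IsPoisson) (hG : Λ.IsHomogeneous G) :
    -- (a) homogeneous functions are the sections of `L^*`
    Set.BijOn B.homFun Set.univ (homogeneousFunctions EP P G) ∧
    (∀ (h : B.DualSection) (x : P) (t : ℝ), h (B.proj x) (B.lineMk x t) = t * B.homFun h x) ∧
    -- (b) the Kirillov bracket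
    (∃! κ : KirillovBracket EK (ℝ →L[ℝ] ℝ) B.DualFiber, ∀ h₁ h₂ : B.DualSection,
      Λ.poissonBracket (B.homFun h₁) (B.homFun h₂) = -B.homFun (κ.bracket h₁ h₂)) ∧
    ∀ κ : KirillovBracket EK (ℝ →L[ℝ] ℝ) B.DualFiber,
      (∀ h₁ h₂ : B.DualSection,
        Λ.poissonBracket (B.homFun h₁) (B.homFun h₂) = -B.homFun (κ.bracket h₁ h₂)) →
      -- `X_h` is the unique symbol of `[·, h]`
      (∀ (h : B.DualSection) (X : SmoothVectorField EK K),
        IsSymbol (fun h₁ => κ.bracket h₁ h) X ↔ X = κ.symbol h) ∧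
      -- (c): `X_H` projects to `-X_h`, which is the symbol of `[h, ·]`
      (∀ h : B.DualSection, IsSymbol (fun h₁ => κ.bracket h h₁) (-κ.symbol h)) ∧
      (∀ (h : B.DualSection) (x : P),
        mfderiv 𝓘(ℝ, EP) 𝓘(ℝ, EK) B.proj x (Λ.hamiltonian (B.homFun h) x) =
          -κ.symbol h (B.proj x)) ∧
      -- (d) brackets of symbols
      (∀ (h₁ h₂ : B.DualSection) (k : K),
        VectorField.mlieBracket 𝓘(ℝ, EK) (κ.symbol h₁) (κ.symbol h₂) k =
          -κ.symbol (κ.bracket h₁ h₂) k) :=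
  mainTheorem1_general G B Λ hΛ hG
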